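/- Consider in $\mathbb{R}^3$ the two-zone homogeneous piecewise linear system $$\dot x = \begin{cases} A^+x, & x_1\ge 0,\\ A^-x, & x_1<0,\end{cases}\qquad x=(x_1,x_2,x_3)^T,$$ where $A^+,A^-$ are real $3\times 3$ matrices that share their second and third columns (so that the vector field is continuous), and suppose that the system is observable, i.e. the matrix with rows $e_1^T,\ e_1^TA^-,\ e_1^T(A^-)^2$ has rank $3$. Suppose that the eigenvalues of $A^\pm$, counted with algebraic multiplicity, are $\lambda^\pm,\ \alpha^\pm+ i\beta^\pm,\ \alpha^\pm- i\beta^\pm$ with $\lambda^\pm,\alpha^\pm,\beta^\pm\in\mathbb{R}$ and $\beta^\pm>0$, and put $\gamma^\pm=(\alpha^\pm-\lambda^\pm)/\beta^\pm$. Suppose that the system has a periodic orbit that crosses the separation plane $x_1=0$, i.e. a periodic solution $x:\mathbb{R}\to\mathbb{R}^3$ which takes values both in $\{x_1>0\}$ and in $\{x_1<0\}$. Then: a) if $\gamma^+=\gamma^-=0$, then $\lambda^+\lambda^-\le 0$; b) if $\gamma^+\ge 0$, $\gamma^-\ge 0$ and $\gamma^++\gamma^-\ne 0$, then at least one of $\lambda^+,\lambda^-$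 is negative; c) if $\gamma^+\le 0$, $\gamma^-\le 0$ and $\gamma^++\gamma^-\ne 0$, then at least one of $\lambda^+,\lambda^-$ is positive. -/

import Mathlib

open scoped Matrix

noncomputable section

namespace PiecewiseLinear

/-- The right-hand side of the two-zone homogeneous piecewise linear system
`ẋ = A⁺ x` for `x₁ ≥ 0`, `ẋ = A⁻ x` for `x₁ < 0` (coordinate `x₁` has index `0`). -/
def field (Ap Am : Matrix (Fin 3) (Fin 3) ℝ) (x : Fin 3 → ℝ) : Fin 3 → ℝ :=
  if 0 ≤ x 0 then Ap *ᵥ x else Am *ᵥ x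

/-- Continuity relation: the two matrices share their second and third columns. -/
def ContinuityRelation (Ap Am : Matrix (Fin 3) (Fin 3) ℝ) : Prop :=
  ∀ i j, j ≠ 0 → Ap i j = Am i j

/-- The observability matrix with rows `e₁ᵀ`, `e₁ᵀ A`, `e₁ᵀ A²`. -/
def observabilityMatrix (A : Matrix (Fin 3) (Fin 3) ℝ) : Matrix (Fin 3) (Fin 3) ℝ :=
  Matrix.of ![Pi.single 0 1, Pi.single 0 1 ᵥ* A, Pi.single 0 1 ᵥ* (A ^ 2)]

/-- The observability matrix has full rank. -/
def Observable (A : Matrix (Fin 3) (Fin 3) ℝ) : Prop :=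
  (observabilityMatrix A).rank = 3

/-- The complex eigenvalues of the real matrix `A`, with algebraic multiplicity,
are `l`, `a + b i` and `a - b i`. -/
def HasEigenvalues (A : Matrix (Fin 3) (Fin 3) ℝ) (l a b : ℝ) : Prop :=
  (A.map (algebraMap ℝ ℂ)).charpoly.roots =
    {(l : ℂ), (a : ℂ) + (b : ℂ) * Complex.I, (a : ℂ) - (b : ℂ) * Complex.I}

/-- The parameter `γ = (α - λ) / β`. -/
def gam (l a b : ℝ) : ℝ := (a - l) / b

/-- `x : ℝ → ℝ³` parametrizes a periodic orbit of the system that crosses the separation plane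
`x₁ = 0`, that is, visits both open half-spaces. In particular it is not an equilibrium, and it
meets the separation plane. -/
structure IsCrossingPeriodicOrbit (Ap Am : Matrix (Fin 3) (Fin 3) ℝ)
    (x : ℝ → Fin 3 → ℝ) : Prop where
  solves : ∀ t, HasDerivAt x (field Ap Am (x t)) t
  periodic : ∃ T : ℝ, 0 < T ∧ ∀ t, x (t + T) = x t
  visits_right : ∃ t, 0 < x t 0
  visits_left : ∃ t, x t 0 < 0

/-- The system has a periodic orbit that crosses the separation plane. -/
def HasPeriodicOrbit (Ap Am : Matrix (Fin 3) (Fin 3) ℝ) : Prop :=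
  ∃ x : ℝ → Fin 3 → ℝ, IsCrossingPeriodicOrbit Ap Am x

end PiecewiseLinear

end

/-! A linear map sends the orbit to one of a system in Liénard form, where the zones differ only in
the coefficients of `x`. Reversing time turns c) into b), and the case of two negative real
eigenvalues in a) into that of two positive ones, so it suffices to exclude a crossing periodic
orbit with `0 ≤ l ≤ a` in both zones, apart from degenerate cases (`false_of_nonneg`). Within a zone
the left eigenform `w = z - l y + l² x` obeys `w' = l w`, and `exp (-2 l t)` times `energy` is
nondecreasing because `l ≤ a`. On `x = 0` the energy is `y² / 2`. Hence a passage of duration `τ`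
from `x = 0` back to `x = 0` multiplies `w` by `k = exp (l τ)` and `|y|` by at least `k`
(`passage`). If `lp < lm`, both eigenforms are positive along the orbit, and the passage estimates
make `y / z` increase strictly over each loop (`false_of_lt`). If `lp = lm`, the common eigenform
has constant sign and `y` itself increases (`false_of_eq`). Either contradicts the maximum attained
over one period (`false_of_increasing`). The reflection `x ↦ -x` gives `lm < lp`. -/

noncomputable section

namespace PiecewiseLinear

/-! ### Characteristic polynomials and reduction to Liénard form -/

/-- The coefficients of the characteristic polynomial of a real `3 × 3` matrix in terms of its
eigenvalues `l`, `a ± b i`. -/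
theorem HasEigenvalues.coefficients {A : Matrix (Fin 3) (Fin 3) ℝ} {l a b : ℝ}
    (h : HasEigenvalues A l a b) :
    A 0 0 + A 1 1 + A 2 2 = l + 2 * a ∧
    (A 0 0 * A 1 1 - A 0 1 * A 1 0) + (A 0 0 * A 2 2 - A 0 2 * A 2 0) +
      (A 1 1 * A 2 2 - A 1 2 * A 2 1) = 2 * a * l + a ^ 2 + b ^ 2 ∧
    A 0 0 * A 1 1 * A 2 2 - A 0 0 * A 1 2 * A 2 1 - A 0 1 * A 1 0 * A 2 2 +
      A 0 1 * A 1 2 * A 2 0 + A 0 2 * A 1 0 * A 2 1 - A 0 2 * A 1 1 * A 2 0 =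
      l * (a ^ 2 + b ^ 2) := by
  have hchar : ∀ μ : ℝ, (Matrix.scalar (Fin 3) μ - A).det =
      (μ - l) * ((μ - a) ^ 2 + b ^ 2) := by
    intro μ
    have hprod := (IsAlgClosed.splits (A.map (algebraMap ℝ ℂ)).charpoly).eq_prod_roots_of_monic
      (Matrix.charpoly_monic _)
    rw [show (A.map (algebraMap ℝ ℂ)).charpoly.roots = _ from h] at hprod
    have heval := congrArg (Polynomial.eval (μ : ℂ)) hprod
    have hmap : (A.map (algebraMap ℝ ℂ)).charpoly.eval (μ : ℂ) =
        (((Matrix.scalar (Fin 3) μ - A).det : ℝ) : ℂ) := by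
      rw [Matrix.charpoly_map, ← Matrix.eval_charpoly]
      exact (Polynomial.eval_map_apply (f := algebraMap ℝ ℂ) (p := A.charpoly) μ)
    rw [hmap] at heval
    have hI : (Complex.I) ^ 2 = -1 := Complex.I_sq
    have hfact : (((Matrix.scalar (Fin 3) μ - A).det : ℝ) : ℂ) =
        (((μ - l) * ((μ - a) ^ 2 + b ^ 2) : ℝ) : ℂ) := by
      rw [heval]
      simp only [Multiset.insert_eq_cons, Multiset.map_cons, Multiset.map_singleton,
        Multiset.prod_cons, Multiset.prod_singleton, Polynomial.eval_mul, Polynomial.eval_sub,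
        Polynomial.eval_X, Polynomial.eval_C]
      push_cast
      linear_combination -((μ : ℂ) - l) * b ^ 2 * hI
    exact_mod_cast hfact
  -- Three values determine a monic cubic.
  have h0 := hchar 0
  have h1 := hchar 1
  have h2 := hchar (-1)
  simp [Matrix.det_fin_three, Matrix.sub_apply, Matrix.scalar_apply] at h0 h1 h2
  refine ⟨?_, ?_, ?_⟩
  · linear_combination h0 - (h1 + h2) / 2
  · linear_combination (h1 - h2) / 2
  · linear_combination -h0

/-- At time `t`, the curve `(x, y, z)` satisfies the linear system in Liénard form whose matrix
has eigenvalues `l`, `a ± b i`. -/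
def LienardAt (l a b : ℝ) (x y z : ℝ → ℝ) (t : ℝ) : Prop :=
  HasDerivAt x ((l + 2 * a) * x t - y t) t ∧
  HasDerivAt y ((2 * a * l + a ^ 2 + b ^ 2) * x t - z t) t ∧
  HasDerivAt z (l * (a ^ 2 + b ^ 2) * x t) t

/-- A crossing periodic solution of a two-zone system in Liénard form. -/
structure LienardOrbit (lp ap bp lm am bm T : ℝ) (x y z : ℝ → ℝ) : Prop where
  right : ∀ t, 0 ≤ x t → LienardAt lp ap bp x y z t
  left : ∀ t, x t ≤ 0 → LienardAt lm am bm x y z t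
  period_pos : 0 < T
  periodic_x : Function.Periodic x T
  periodic_y : Function.Periodic y T
  periodic_z : Function.Periodic z T
  visits_right : ∃ t, 0 < x t
  visits_left : ∃ t, x t < 0

/-- The new coordinates involve only the two shared columns, so a single linear map serves both
zones; the first column enters only through the characteristic coefficients. -/
theorem IsCrossingPeriodicOrbit.exists_lienardOrbit {Ap Am : Matrix (Fin 3) (Fin 3) ℝ}
    {lp ap bp lm am bm : ℝ} (hcont : ContinuityRelation Ap Am)
    (hAp : HasEigenvalues Ap lp ap bp) (hAm : HasEigenvalues Am lm am bm)
    {x : ℝ → Fin 3 → ℝ} (hx : IsCrossingPeriodicOrbit Ap Am x) :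
    ∃ (T : ℝ) (u v w : ℝ → ℝ), LienardOrbit lp ap bp lm am bm T u v w := by
  obtain ⟨T, hT, hper⟩ := hx.periodic
  have key : ∀ (A : Matrix (Fin 3) (Fin 3) ℝ) (l a b : ℝ), HasEigenvalues A l a b →
      (∀ i j, j ≠ 0 → A i j = Am i j) → ∀ t, field Ap Am (x t) = A *ᵥ x t →
      LienardAt l a b (fun t => x t 0)
        (fun t => (Am 1 1 + Am 2 2) * x t 0 - Am 0 1 * x t 1 - Am 0 2 * x t 2)
        (fun t => (Am 1 1 * Am 2 2 - Am 1 2 * Am 2 1) * x t 0 +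
          (Am 0 2 * Am 2 1 - Am 0 1 * Am 2 2) * x t 1 +
          (Am 0 1 * Am 1 2 - Am 0 2 * Am 1 1) * x t 2) t := by
    intro A l a b hA hAA t hf
    obtain ⟨c1, c2, c3⟩ := hA.coefficients
    have hd := hx.solves t
    rw [hf, hasDerivAt_pi] at hd
    have hcol : ∀ i, (A *ᵥ x t) i = A i 0 * x t 0 + A i 1 * x t 1 + A i 2 * x t 2 := by
      intro i
      simp [Matrix.mulVec, dotProduct, Fin.sum_univ_three]
    have d0 := hd 0
    have d1 := hd 1
    have d2 := hd 2
    rw [hcol] at d0 d1 d2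
    simp only [hAA _ 1 (by decide), hAA _ 2 (by decide)] at c1 c2 c3 d0 d1 d2
    refine ⟨?_, ?_, ?_⟩
    · refine HasDerivAt.congr_deriv (d0) ?_
      rw [← c1]; ring
    · refine HasDerivAt.congr_deriv (((d0.const_mul (Am 1 1 + Am 2 2)).sub (d1.const_mul (Am 0 1))).sub
        (d2.const_mul (Am 0 2))) ?_
      rw [← c2]; ring
    · refine HasDerivAt.congr_deriv (((d0.const_mul (Am 1 1 * Am 2 2 - Am 1 2 * Am 2 1)).add
        (d1.const_mul (Am 0 2 * Am 2 1 - Am 0 1 * Am 2 2))).add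
        (d2.const_mul (Am 0 1 * Am 1 2 - Am 0 2 * Am 1 1))) ?_
      rw [← c3]; ring
  refine ⟨T, _, _, _, fun t ht => key Ap lp ap bp hAp hcont t (if_pos ht),
    fun t ht => key Am lm am bm hAm (fun _ _ _ => rfl) t ?_, hT, fun t => ?_, fun t => ?_,
    fun t => ?_, hx.visits_right, hx.visits_left⟩
  · rcases lt_or_eq_of_le (show x t 0 ≤ 0 from ht) with h | h
    · exact if_neg (not_le.2 h)
    -- On the plane `x = 0` the two fields agree, so the left equations hold up to the boundary.
    · rw [field, if_pos h.ge]
      ext i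
      simp [Matrix.mulVec, dotProduct, Fin.sum_univ_three, h, hcont i 1 (by decide),
        hcont i 2 (by decide)]
  all_goals simp only [hper]

/-! ### Symmetries and continuity -/

namespace LienardOrbit

variable {lp ap bp lm am bm T : ℝ} {x y z : ℝ → ℝ}

/-- The reflection `x ↦ -x` exchanges the two zones. -/
theorem reflect (h : LienardOrbit lp ap bp lm am bm T x y z) :
    LienardOrbit lm am bm lp ap bp T (fun t => -x t) (fun t => -y t) (fun t => -z t) := by
  have key : ∀ l a b t, LienardAt l a b x y z t →
      LienardAt l a b (fun t => -x t) (fun t => -y t) (fun t => -z t) t := by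
    rintro l a b t ⟨h1, h2, h3⟩
    refine ⟨?_, ?_, ?_⟩
    · refine HasDerivAt.congr_deriv (h1.fun_neg) ?_; ring
    · refine HasDerivAt.congr_deriv (h2.fun_neg) ?_; ring
    · refine HasDerivAt.congr_deriv (h3.fun_neg) ?_; ring
  obtain ⟨r, hr⟩ := h.visits_right
  obtain ⟨s, hs⟩ := h.visits_left
  exact ⟨fun t ht => key _ _ _ t (h.left t (by linarith)),
    fun t ht => key _ _ _ t (h.right t (by linarith)), h.period_pos,
    fun t => by simp only [h.periodic_x t], fun t => by simp only [h.periodic_y t],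
    fun t => by simp only [h.periodic_z t], ⟨s, by linarith⟩, ⟨r, by linarith⟩⟩

/-- Time reversal changes the sign of the eigenvalues. -/
theorem reverse (h : LienardOrbit lp ap bp lm am bm T x y z) :
    LienardOrbit (-lp) (-ap) bp (-lm) (-am) bm T (fun t => x (-t)) (fun t => -y (-t))
      (fun t => z (-t)) := by
  have key : ∀ l a b t, LienardAt l a b x y z (-t) →
      LienardAt (-l) (-a) b (fun t => x (-t)) (fun t => -y (-t)) (fun t => z (-t)) t := by
    rintro l a b t ⟨h1, h2, h3⟩
    have hn : HasDerivAt (fun t : ℝ => -t) (-1) t := (hasDerivAt_id t).fun_neg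
    refine ⟨?_, ?_, ?_⟩
    · refine HasDerivAt.congr_deriv (HasDerivAt.comp t h1 hn) ?_; ring
    · refine HasDerivAt.congr_deriv ((HasDerivAt.comp t h2 hn).fun_neg) ?_; ring
    · refine HasDerivAt.congr_deriv (HasDerivAt.comp t h3 hn) ?_; ring
  have hper : ∀ {f : ℝ → ℝ}, Function.Periodic f T → ∀ t, f (-(t + T)) = f (-t) := by
    intro f hf t
    rw [← hf (-(t + T))]
    congr 1; ring
  obtain ⟨r, hr⟩ := h.visits_right
  obtain ⟨s, hs⟩ := h.visits_left
  exact ⟨fun t ht => key _ _ _ t (h.right _ ht), fun t ht => key _ _ _ t (h.left _ ht),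
    h.period_pos, hper h.periodic_x, fun t => congrArg _ (hper h.periodic_y t),
    hper h.periodic_z, ⟨-r, by simpa using hr⟩, ⟨-s, by simpa using hs⟩⟩

theorem continuous_x (h : LienardOrbit lp ap bp lm am bm T x y z) : Continuous x :=
  continuous_iff_continuousAt.2 fun t => (le_total 0 (x t)).elim
    (fun ht => (h.right t ht).1.continuousAt) fun ht => (h.left t ht).1.continuousAt

theorem continuous_y (h : LienardOrbit lp ap bp lm am bm T x y z) : Continuous y :=
  continuous_iff_continuousAt.2 fun t => (le_total 0 (x t)).elim
    (fun ht => (h.right t ht).2.1.continuousAt) fun ht => (h.left t ht).2.1.continuousAt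

theorem continuous_z (h : LienardOrbit lp ap bp lm am bm T x y z) : Continuous z :=
  continuous_iff_continuousAt.2 fun t => (le_total 0 (x t)).elim
    (fun ht => (h.right t ht).2.2.continuousAt) fun ht => (h.left t ht).2.2.continuousAt

end LienardOrbit

/-! ### Eigenform and energy identities -/

/-- The linear form that spans the left eigenspace of the eigenvalue `l` in Liénard form. -/
def eigenform (l x y z : ℝ) : ℝ := z - l * y + l ^ 2 * x

/-- A quadratic quantity whose growth along orbits is controlled by the sign of `a - l`. -/
def energy (l a b x y z : ℝ) : ℝ :=
  (2 * a * x - y) ^ 2 / 2 + ((a - l) ^ 2 + b ^ 2) * x ^ 2 / 2 - eigenform l x y z * x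

theorem hasDerivAt_eigenform {l a b m : ℝ} {x y z : ℝ → ℝ} {t : ℝ}
    (h : LienardAt l a b x y z t) :
    HasDerivAt (fun t => eigenform m (x t) (y t) (z t))
      (m * eigenform m (x t) (y t) (z t) - (m - l) * ((m - a) ^ 2 + b ^ 2) * x t) t := by
  obtain ⟨h1, h2, h3⟩ := h
  refine HasDerivAt.congr_deriv ((h3.sub (h2.const_mul m)).add (h1.const_mul (m ^ 2))) ?_
  simp only [eigenform]; ring

theorem hasDerivAt_exp_mul_energy {l a b : ℝ} {x y z : ℝ → ℝ} {t : ℝ}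
    (h : LienardAt l a b x y z t) :
    HasDerivAt (fun t => Real.exp (-(2 * l * t)) * energy l a b (x t) (y t) (z t))
      (Real.exp (-(2 * l * t)) * (2 * (a - l) * (2 * a * x t - y t) ^ 2)) t := by
  have hw := hasDerivAt_eigenform (m := l) h
  obtain ⟨h1, h2, h3⟩ := h
  have he : HasDerivAt (fun t : ℝ => Real.exp (-(2 * l * t)))
      (Real.exp (-(2 * l * t)) * -(2 * l)) t := by
    have := ((hasDerivAt_id t).const_mul (2 * l)).fun_neg.exp
    simpa using this
  have hu := (h1.const_mul (2 * a)).sub h2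
  have hE := (((hu.fun_pow 2).div_const 2).add
    (((h1.fun_pow 2).const_mul ((a - l) ^ 2 + b ^ 2)).div_const 2)).sub (hw.mul h1)
  refine HasDerivAt.congr_deriv (he.mul hE) ?_
  simp only [energy, eigenform, Pi.sub_apply]
  norm_num
  ring

/-! ### Real-variable lemmas on signs, zeros and periodic functions -/

open Set Filter Topology

theorem exists_lt_of_hasDerivAt_neg {f : ℝ → ℝ} {f' t : ℝ} (h : HasDerivAt f f' t)
    (hf : f' < 0) : ∃ ε > 0, (∀ s, t < s → s < t + ε → f s < f t) ∧
      ∀ s, t - ε < s → s < t → f t < f s := by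
  have hs := (hasDerivAt_iff_tendsto_slope.1 h).eventually (gt_mem_nhds hf)
  rw [eventually_nhdsWithin_iff, Metric.eventually_nhds_iff] at hs
  obtain ⟨ε, hε, H⟩ := hs
  refine ⟨ε, hε, fun s h1 h2 => ?_, fun s h1 h2 => ?_⟩
  · have := H (by rw [Real.dist_eq, abs_lt]; constructor <;> linarith : dist s t < ε) h1.ne'
    rw [slope_def_field, div_neg_iff] at this
    rcases this with ⟨_, _⟩ | ⟨_, _⟩ <;> linarith
  · have := H (by rw [Real.dist_eq, abs_lt]; constructor <;> linarith : dist s t < ε) h2.ne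
    rw [slope_def_field, div_neg_iff] at this
    rcases this with ⟨_, _⟩ | ⟨_, _⟩ <;> linarith

theorem exists_first_zero {f : ℝ → ℝ} (hf : Continuous f) {c d : ℝ} (hcd : c < d)
    (hc : f c < 0) (hd : 0 < f d) : ∃ t, c < t ∧ f t = 0 ∧ ∀ s, c ≤ s → s < t → f s < 0 := by
  have hK : IsCompact (Icc c d ∩ {t | f t = 0}) :=
    isCompact_Icc.inter_right (isClosed_eq hf continuous_const)
  have hne : (Icc c d ∩ {t | f t = 0}).Nonempty := by
    obtain ⟨t, ht, h0⟩ := intermediate_value_Icc hcd.le hf.continuousOn ⟨hc.le, hd.le⟩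
    exact ⟨t, ht, h0⟩
  obtain ⟨t, ⟨⟨h1, h2⟩, h0 : f t = 0⟩, hmin⟩ := hK.exists_isLeast hne
  refine ⟨t, h1.lt_of_ne fun h => by rw [← h] at h0; linarith, h0, fun s hs hst => ?_⟩
  by_contra! hfs
  obtain ⟨r, hr, hr0⟩ := intermediate_value_Icc hs hf.continuousOn ⟨hc.le, hfs⟩
  have := hmin ⟨⟨hr.1, by linarith [hr.2]⟩, hr0⟩
  linarith [hr.2]

theorem exists_last_zero {f : ℝ → ℝ} (hf : Continuous f) {c d : ℝ} (hcd : c < d)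
    (hc : 0 < f c) (hd : f d < 0) : ∃ t, t < d ∧ f t = 0 ∧ ∀ s, t < s → s ≤ d → f s < 0 := by
  obtain ⟨t, h1, h2, h3⟩ := exists_first_zero (f := fun s => f (-s)) (hf.comp continuous_neg)
    (neg_lt_neg hcd) (by simpa using hd) (by simpa using hc)
  refine ⟨-t, by linarith, h2, fun s hs hsd => ?_⟩
  simpa using h3 (-s) (by linarith) (by linarith)

/-- A function with nonnegative derivative that takes the same value at the end points of an
interval has zero derivative in between. -/
theorem deriv_eq_zero_of_eq_endpoints {f f' : ℝ → ℝ} {c d : ℝ} (hcd : c < d)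
    (h : ∀ t ∈ Icc c d, HasDerivAt f (f' t) t) (hf' : ∀ t ∈ Icc c d, 0 ≤ f' t) :
    MonotoneOn f (Icc c d) ∧ (f c = f d → ∀ t ∈ Ioo c d, f' t = 0) := by
  have hmono : MonotoneOn f (Icc c d) := by
    refine monotoneOn_of_deriv_nonneg (convex_Icc c d)
      (fun t ht => (h t ht).continuousAt.continuousWithinAt)
      (fun t ht => (h t (interior_subset ht)).differentiableAt.differentiableWithinAt)
      fun t ht => ?_
    rw [(h t (interior_subset ht)).deriv]
    exact hf' t (interior_subset ht)
  refine ⟨hmono, fun heq t ht => ?_⟩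
  have hconst : f =ᶠ[𝓝 t] fun _ => f c := by
    filter_upwards [Ioo_mem_nhds ht.1 ht.2] with s hs
    have h1 := hmono (left_mem_Icc.2 hcd.le) (Ioo_subset_Icc_self hs) hs.1.le
    have h2 := hmono (Ioo_subset_Icc_self hs) (right_mem_Icc.2 hcd.le) hs.2.le
    linarith
  exact (h t (Ioo_subset_Icc_self ht)).unique
    ((hasDerivAt_const t (f c)).congr_of_eventuallyEq hconst)

theorem deriv_eq_zero_of_periodic {f f' : ℝ → ℝ} {T : ℝ} (hT : 0 < T)
    (hper : Function.Periodic f T) (h : ∀ t, HasDerivAt f (f' t) t) (hf' : ∀ t, 0 ≤ f' t)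
    (t : ℝ) : f' t = 0 := by
  refine (deriv_eq_zero_of_eq_endpoints (c := t - T) (d := t + T) (by linarith)
    (fun t _ => h t) fun t _ => hf' t).2 ?_ t ⟨by linarith, by linarith⟩
  rw [hper t]
  have := hper (t - T)
  rw [← this]; congr 1; ring

/-- A periodic solution of `f' = l f + g` with `l ≥ 0`, `g ≤ 0`, `g ≠ 0` is positive. -/
theorem pos_of_periodic_of_hasDerivAt {f g : ℝ → ℝ} {l T : ℝ} (hl : 0 ≤ l) (hT : 0 < T)
    (hper : Function.Periodic f T) (h : ∀ t, HasDerivAt f (l * f t + g t) t)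
    (hg : ∀ t, g t ≤ 0) (hg' : ∃ t, g t < 0) (t : ℝ) : 0 < f t := by
  by_contra! hft
  have hanti : Antitone fun s => Real.exp (-(l * s)) * f s := by
    have hd : ∀ s, HasDerivAt (fun s => Real.exp (-(l * s)) * f s)
        (Real.exp (-(l * s)) * g s) s := by
      intro s
      have he : HasDerivAt (fun s : ℝ => Real.exp (-(l * s))) (Real.exp (-(l * s)) * -l) s := by
        simpa using ((hasDerivAt_id s).const_mul l).fun_neg.exp
      exact (he.mul (h s)).congr_deriv (by ring)
    refine antitone_of_deriv_nonpos (fun s => (hd s).differentiableAt) fun s => ?_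
    rw [(hd s).deriv]
    exact mul_nonpos_of_nonneg_of_nonpos (Real.exp_pos _).le (hg s)
  -- Nonpositivity at `t` persists forward in time, hence everywhere by periodicity. Then `f' ≤ 0`,
  -- and periodicity forces `f' = 0`, against `g < 0` somewhere.
  have hle : ∀ s, f s ≤ 0 := by
    intro s
    obtain ⟨r, hr, hrs⟩ := hper.exists_mem_Ico hT s t
    have h1 := hanti hr.1
    have h2 : Real.exp (-(l * t)) * f t ≤ 0 :=
      mul_nonpos_of_nonneg_of_nonpos (Real.exp_pos _).le hft
    rw [hrs]
    by_contra! h3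
    have h4 : 0 < Real.exp (-(l * r)) * f r := mul_pos (Real.exp_pos _) h3
    simp only at h1
    linarith
  obtain ⟨s, hs⟩ := hg'
  have hz := deriv_eq_zero_of_periodic (f := fun t => -f t) hT
    (fun t => congrArg _ (hper t)) (fun t => (h t).fun_neg)
    (fun t => by nlinarith [hg t, hle t]) s
  nlinarith [hle s]

/-! ### Passages through one zone -/

theorem hasDerivAt_exp_neg_mul (l t : ℝ) :
    HasDerivAt (fun s : ℝ => Real.exp (-(l * s))) (Real.exp (-(l * t)) * -l) t := by
  simpa using ((hasDerivAt_id t).const_mul l).fun_neg.exp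

/-- The effect on the eigenform and on `y` of a passage from `x = 0` to `x = 0` in one zone. -/
theorem passage {l a b c d : ℝ} {x y z : ℝ → ℝ} (hcd : c < d) (hl : 0 ≤ l) (hla : l ≤ a)
    (h : ∀ t ∈ Icc c d, LienardAt l a b x y z t) (hc : x c = 0) (hd : x d = 0)
    (hne : ∃ t ∈ Ioo c d, x t ≠ 0) :
    ∃ k : ℝ, 1 ≤ k ∧ (0 < l → 1 < k) ∧
      eigenform l 0 (y d) (z d) = k * eigenform l 0 (y c) (z c) ∧
      (k * y c) ^ 2 ≤ y d ^ 2 ∧ (l < a → (k * y c) ^ 2 < y d ^ 2) ∧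
      (∀ t ∈ Icc c d, 0 < energy l a b (x t) (y t) (z t) → y d ≠ 0) := by
  have hexp : ∀ t, Real.exp (-(l * t)) * Real.exp (l * (t - c)) = Real.exp (-(l * c)) := by
    intro t
    rw [← Real.exp_add]; congr 1; ring
  have hw : Real.exp (-(l * d)) * eigenform l (x d) (y d) (z d) =
      Real.exp (-(l * c)) * eigenform l (x c) (y c) (z c) := by
    have hderiv : ∀ t ∈ Icc c d, HasDerivAt
        (fun t => Real.exp (-(l * t)) * eigenform l (x t) (y t) (z t)) 0 t := fun t ht =>
      ((hasDerivAt_exp_neg_mul l t).mul (hasDerivAt_eigenform (h t ht))).congr_deriv (by ring)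
    exact constant_of_has_deriv_right_zero
      (fun t ht => (hderiv t ht).continuousAt.continuousWithinAt)
      (fun t ht => (hderiv t (Ico_subset_Icc_self ht)).hasDerivWithinAt) d
      (right_mem_Icc.2 hcd.le)
  rw [hc, hd, ← hexp d, mul_assoc] at hw
  obtain ⟨hmono, hstrict⟩ := deriv_eq_zero_of_eq_endpoints hcd
    (fun t ht => hasDerivAt_exp_mul_energy (h t ht)) fun t _ => mul_nonneg (Real.exp_pos _).le
      (mul_nonneg (by linarith) (sq_nonneg _))
  have hzero : ∀ y z, energy l a b 0 y z = y ^ 2 / 2 := by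
    intro y z
    simp [energy]
  -- The exponential weights at `c` and `d` differ by the factor `k²`, so monotonicity of the
  -- weighted energy reads `k² y(c)² ≤ y(d)²`.
  have hsq : Real.exp (-(2 * l * c)) = Real.exp (-(2 * l * d)) * Real.exp (l * (d - c)) ^ 2 := by
    rw [← Real.exp_nat_mul, ← Real.exp_add]; congr 1; push_cast; ring
  have hpos := Real.exp_pos (-(2 * l * d))
  have hle := hmono (left_mem_Icc.2 hcd.le) (right_mem_Icc.2 hcd.le) hcd.le
  simp only [hc, hd, hzero, hsq] at hle hstrict
  rw [mul_assoc] at hle hstrict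
  have hle' := le_of_mul_le_mul_left hle hpos
  refine ⟨Real.exp (l * (d - c)), Real.one_le_exp (mul_nonneg hl (by linarith)),
    fun hl' => Real.one_lt_exp_iff.2 (mul_pos hl' (by linarith)),
    mul_left_cancel₀ (Real.exp_pos _).ne' hw, ?_, ?_, ?_⟩
  · rw [mul_pow]; linarith
  · intro hla'
    refine lt_of_le_of_ne (by rw [mul_pow]; linarith) fun heq => ?_
    have hder := hstrict (by rw [mul_pow] at heq; congr 1; linarith)
    have hu : ∀ t ∈ Ioo c d, 2 * a * x t - y t = 0 := by
      intro t ht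
      have h1 := hder t ht
      have h2 := Real.exp_pos (-(2 * l * t))
      have h3 : a - l ≠ 0 := by linarith
      simpa [h3] using h1
    obtain ⟨t, ht, hxt⟩ := hne
    -- Since `2 a x - y = x' - l x`, equality would make `exp (-l s) x` constant, hence zero as `x c
    -- = 0`.
    have hderiv : ∀ s ∈ Icc c d, HasDerivAt (fun s => Real.exp (-(l * s)) * x s)
        (Real.exp (-(l * s)) * (2 * a * x s - y s)) s := fun s hs =>
      ((hasDerivAt_exp_neg_mul l s).mul (h s hs).1).congr_deriv (by ring)
    have hsub : Icc c t ⊆ Icc c d := Icc_subset_Icc_right ht.2.le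
    obtain ⟨s, hs, hs'⟩ := exists_hasDerivAt_eq_slope _ _ ht.1
      (fun s hs => (hderiv s (hsub hs)).continuousAt.continuousWithinAt)
      (fun s hs => hderiv s (hsub (Ioo_subset_Icc_self hs)))
    rw [hu s ⟨hs.1, hs.2.trans ht.2⟩, hc] at hs'
    have h1 : t - c ≠ 0 := by linarith [ht.1]
    have h2 := (Real.exp_pos (-(l * t))).ne'
    simp only [mul_zero, sub_zero] at hs'
    exact div_ne_zero (mul_ne_zero h2 hxt) h1 hs'.symm
  · intro t ht hE hyd
    have h1 := hmono ht (right_mem_Icc.2 hcd.le) ht.2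
    simp only [hd, hzero, hyd] at h1
    have h2 := mul_pos (Real.exp_pos (-(2 * l * t))) hE
    norm_num at h1
    linarith

namespace LienardOrbit

variable {lp ap bp lm am bm T : ℝ} {x y z : ℝ → ℝ}

/-- A passage through the left zone, started at a last zero of `x` before time `c`. -/
theorem left_passage (h : LienardOrbit lp ap bp lm am bm T x y z) (hl : 0 ≤ lm) (hla : lm ≤ am)
    {t₀ c : ℝ} (h0 : x t₀ = 0) (hc : t₀ < c) (hneg : ∀ s, t₀ < s → s ≤ c → x s < 0)
    (hstart : 0 < y t₀ ∨ 0 < energy lm am bm (x c) (y c) (z c)) :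
    ∃ t₁ k : ℝ, t₀ < t₁ ∧ x t₁ = 0 ∧ y t₁ < 0 ∧ 1 ≤ k ∧ (0 < lm → 1 < k) ∧
      eigenform lm 0 (y t₁) (z t₁) = k * eigenform lm 0 (y t₀) (z t₀) ∧
      k * y t₀ ≤ -y t₁ ∧ (lm < am → k * y t₀ < -y t₁) := by
  obtain ⟨r, hr⟩ := h.visits_right
  obtain ⟨r', hr', hrr'⟩ := h.periodic_x.exists_mem_Ico h.period_pos r (c + 1)
  rw [hrr'] at hr
  obtain ⟨t₁, h1, h2, h3⟩ := exists_first_zero h.continuous_x (by linarith [hr'.1])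
    (hneg c hc le_rfl) hr
  have hneg' : ∀ s, t₀ < s → s < t₁ → x s < 0 := fun s hs hs' =>
    (le_total s c).elim (hneg s hs) fun hcs => h3 s hcs hs'
  have hle : ∀ s ∈ Icc t₀ t₁, x s ≤ 0 := by
    intro s hs
    rcases eq_or_lt_of_le hs.1 with rfl | hs1
    · exact h0.le
    rcases eq_or_lt_of_le hs.2 with rfl | hs2
    · exact h2.le
    exact (hneg' s hs1 hs2).le
  obtain ⟨k, hk1, hk2, hk3, hk4, hk5, hk6⟩ := passage (hc.trans h1) hl hla
    (fun t ht => h.left t (hle t ht)) h0 h2 ⟨c, ⟨hc, h1⟩, (hneg c hc le_rfl).ne⟩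
  have hy1 : y t₁ ≤ 0 := by
    -- With `y t₁ > 0`, `x` would be decreasing through `t₁`, hence positive just before it.
    by_contra! hy
    have hd := (h.left t₁ h2.le).1
    obtain ⟨ε, hε, -, hlt⟩ := exists_lt_of_hasDerivAt_neg hd (by rw [h2]; linarith)
    obtain ⟨s, hs1, hs2⟩ := exists_between (max_lt (hc.trans h1) (sub_lt_self t₁ hε))
    have h4 := hlt s ((le_max_right _ _).trans_lt hs1) hs2
    have h5 := hneg' s ((le_max_left _ _).trans_lt hs1) hs2
    linarith
  -- The exit is transversal because `|y|` cannot shrink, or because positive energy inside the zone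
  -- survives until the exit.
  have hy1' : y t₁ ≠ 0 := by
    rcases hstart with hy | hE
    · intro h4
      rw [h4] at hk4
      have : 0 < k * y t₀ := by positivity
      nlinarith
    · exact hk6 c ⟨hc.le, h1.le⟩ hE
  refine ⟨t₁, k, hc.trans h1, h2, lt_of_le_of_ne hy1 hy1', hk1, hk2, hk3, ?_, fun hlt => ?_⟩
  · nlinarith
  · have := hk5 hlt
    nlinarith

theorem exists_neg_right (h : LienardOrbit lp ap bp lm am bm T x y z) {t : ℝ} (h0 : x t = 0)
    (hy : 0 < y t) : ∃ c, t < c ∧ ∀ s, t < s → s ≤ c → x s < 0 := by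
  obtain ⟨ε, hε, hlt, -⟩ := exists_lt_of_hasDerivAt_neg (h.left t h0.le).1 (by rw [h0]; linarith)
  exact ⟨t + ε / 2, by linarith, fun s hs hs' => by
    have := hlt s hs (by linarith); rwa [h0] at this⟩

/-- A passage through the right zone. -/
theorem right_passage (h : LienardOrbit lp ap bp lm am bm T x y z) (hl : 0 ≤ lp) (hla : lp ≤ ap)
    {t₁ : ℝ} (h0 : x t₁ = 0) (hy : y t₁ < 0) :
    ∃ t₂ k : ℝ, t₁ < t₂ ∧ x t₂ = 0 ∧ 0 < y t₂ ∧ 1 ≤ k ∧ (0 < lp → 1 < k) ∧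
      eigenform lp 0 (y t₂) (z t₂) = k * eigenform lp 0 (y t₁) (z t₁) ∧
      k * -y t₁ ≤ y t₂ ∧ (lp < ap → k * -y t₁ < y t₂) := by
  obtain ⟨c, hc, hneg⟩ := h.reflect.exists_neg_right (t := t₁) (by simpa using h0)
    (by simpa using hy)
  obtain ⟨t₂, k, h1, h2, h3, h4, h5, h6, h7, h8⟩ := h.reflect.left_passage hl hla (t₀ := t₁)
    (by simpa using h0) hc hneg (Or.inl (by simpa using hy))
  refine ⟨t₂, k, h1, by simpa using h2, by simpa using h3, h4, h5, ?_, by simpa using h7,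
    by simpa using h8⟩
  simp only [eigenform] at h6 ⊢
  linarith

/-- A point where the orbit crosses from the right zone to the left zone transversally. -/
theorem exists_crossing (h : LienardOrbit lp ap bp lm am bm T x y z) (hlp : 0 ≤ lp)
    (hlap : lp ≤ ap) (hlm : 0 ≤ lm) (hlam : lm ≤ am) (hbm : bm ≠ 0)
    (hw : ∀ t, x t < 0 → 0 ≤ eigenform lm (x t) (y t) (z t)) : ∃ t, x t = 0 ∧ 0 < y t := by
  obtain ⟨s, hs⟩ := h.visits_left
  obtain ⟨r, hr⟩ := h.visits_right
  obtain ⟨s', hs', hss'⟩ := h.periodic_x.exists_mem_Ico h.period_pos s (r + 1)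
  rw [hss'] at hs
  obtain ⟨t₀, h1, h2, h3⟩ := exists_last_zero h.continuous_x (by linarith [hs'.1]) hr hs
  -- For `x < 0 ≤ w` the term `-w x` is nonnegative, and `bm ≠ 0` makes the `x²` term positive.
  have hE : 0 < energy lm am bm (x s') (y s') (z s') := by
    have h4 : 0 < bm ^ 2 := by positivity
    have h5 : 0 < ((am - lm) ^ 2 + bm ^ 2) * x s' ^ 2 :=
      mul_pos (by positivity) (by nlinarith)
    have h6 := mul_nonneg (hw s' hs) (neg_nonneg.2 hs.le)
    have h7 := sq_nonneg (2 * am * x s' - y s')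
    simp only [energy]
    linarith
  obtain ⟨t₁, k, -, h5, h6, -⟩ := h.left_passage hlm hlam h2 h1 h3 (Or.inr hE)
  obtain ⟨t₂, k, -, h7, h8, -⟩ := h.right_passage hlp hlap h5 h6
  exact ⟨t₂, h7, h8⟩

/-! ### Contradiction from a functional increasing along loops -/

/-- No continuous functional that is positive at transversal crossings and nonpositive at
tangencies can increase along every loop. -/
theorem false_of_increasing (h : LienardOrbit lp ap bp lm am bm T x y z) (f : ℝ → ℝ → ℝ)
    (hf : ContinuousOn (fun t => f (y t) (z t)) {t | x t = 0 ∧ 0 ≤ y t})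
    (hf0 : ∀ t, x t = 0 → y t = 0 → f (y t) (z t) ≤ 0)
    (hfpos : ∀ t, x t = 0 → 0 < y t → 0 < f (y t) (z t))
    (hex : ∃ t, x t = 0 ∧ 0 < y t)
    (hinc : ∀ t, x t = 0 → 0 < y t → ∃ t', x t' = 0 ∧ 0 < y t' ∧
      f (y t) (z t) < f (y t') (z t')) : False := by
  have hclosed : IsClosed {t | x t = 0 ∧ 0 ≤ y t} :=
    (isClosed_eq h.continuous_x continuous_const).inter
      (isClosed_le continuous_const h.continuous_y)
  have hmod : ∀ t, ∃ s ∈ Icc 0 T, x s = x t ∧ y s = y t ∧ z s = z t := by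
    intro t
    have hp : Function.Periodic (fun t => (x t, y t, z t)) T := fun t => by
      simp only [h.periodic_x t, h.periodic_y t, h.periodic_z t]
    obtain ⟨s, hs, hst⟩ := hp.exists_mem_Ico₀ h.period_pos t
    simp only [Prod.mk.injEq] at hst
    exact ⟨s, Ico_subset_Icc_self hs, hst.1.symm, hst.2.1.symm, hst.2.2.symm⟩
  obtain ⟨t, ht0, hty⟩ := hex
  obtain ⟨s, hs, e1, e2, e3⟩ := hmod t
  obtain ⟨m, ⟨hm, hm0, hmy⟩, hmax⟩ := (isCompact_Icc.inter_right hclosed).exists_isMaxOn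
    (s := Icc 0 T ∩ {t | x t = 0 ∧ 0 ≤ y t}) ⟨s, hs, by rw [e1, ht0], by rw [e2]; exact hty.le⟩
    (hf.mono inter_subset_right)
  have hle : ∀ t, x t = 0 → 0 < y t → f (y t) (z t) ≤ f (y m) (z m) := by
    intro t ht0 hty
    obtain ⟨s, hs, e1, e2, e3⟩ := hmod t
    have : f (y s) (z s) ≤ f (y m) (z m) :=
      hmax ⟨hs, by rw [e1, ht0], by rw [e2]; exact hty.le⟩
    rwa [e2, e3] at this
  -- A tangency has value at most `0`, below that of a transversal crossing, so it cannot be the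
  -- maximum.
  have hmy' : 0 < y m := by
    refine lt_of_le_of_ne hmy fun h0 => ?_
    have h1 := hf0 m hm0 h0.symm
    have h2 := hfpos t ht0 hty
    linarith [hle t ht0 hty]
  obtain ⟨t', h1, h2, h3⟩ := hinc m hm0 hmy'
  linarith [hle t' h1 h2]

/-- If the two real eigenvalues differ, the eigenform of the right zone is positive. -/
theorem eigenform_right_pos (h : LienardOrbit lp ap bp lm am bm T x y z) (hlp : 0 ≤ lp)
    (hlt : lp < lm) (hbm : bm ≠ 0) (t : ℝ) : 0 < eigenform lp (x t) (y t) (z t) := by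
  have hc : 0 < (lm - lp) * ((lp - am) ^ 2 + bm ^ 2) :=
    mul_pos (by linarith) (by positivity)
  refine pos_of_periodic_of_hasDerivAt
    (f := fun t => eigenform lp (x t) (y t) (z t))
    (g := fun t => (lm - lp) * ((lp - am) ^ 2 + bm ^ 2) * min (x t) 0) hlp h.period_pos
    (fun t => by simp only [h.periodic_x t, h.periodic_y t, h.periodic_z t]) (fun t => ?_)
    (fun t => mul_nonpos_of_nonneg_of_nonpos hc.le (min_le_right _ _)) ?_ t
  · rcases le_total 0 (x t) with ht | ht
    · refine (hasDerivAt_eigenform (h.right t ht)).congr_deriv ?_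
      rw [min_eq_right ht]; ring
    · refine (hasDerivAt_eigenform (h.left t ht)).congr_deriv ?_
      rw [min_eq_left ht]; ring
  · obtain ⟨s, hs⟩ := h.visits_left
    exact ⟨s, mul_neg_of_pos_of_neg hc (by rwa [min_eq_left hs.le])⟩

/-- If the two real eigenvalues differ, the eigenform of the left zone is positive. -/
theorem eigenform_left_pos (h : LienardOrbit lp ap bp lm am bm T x y z) (hlp : 0 ≤ lp)
    (hlt : lp < lm) (hbp : bp ≠ 0) (t : ℝ) : 0 < eigenform lm (x t) (y t) (z t) := by
  have hc : 0 < (lm - lp) * ((lm - ap) ^ 2 + bp ^ 2) :=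
    mul_pos (by linarith) (by positivity)
  refine pos_of_periodic_of_hasDerivAt
    (f := fun t => eigenform lm (x t) (y t) (z t))
    (g := fun t => -((lm - lp) * ((lm - ap) ^ 2 + bp ^ 2) * max (x t) 0)) (hlp.trans hlt.le)
    h.period_pos (fun t => by simp only [h.periodic_x t, h.periodic_y t, h.periodic_z t])
    (fun t => ?_) (fun t => neg_nonpos.2 (mul_nonneg hc.le (le_max_right _ _))) ?_ t
  · rcases le_total 0 (x t) with ht | ht
    · refine (hasDerivAt_eigenform (h.right t ht)).congr_deriv ?_
      rw [max_eq_left ht]; ring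
    · refine (hasDerivAt_eigenform (h.left t ht)).congr_deriv ?_
      rw [max_eq_right ht]; ring
  · obtain ⟨s, hs⟩ := h.visits_right
    exact ⟨s, neg_lt_zero.2 (mul_pos hc (by rwa [max_eq_left hs.le]))⟩

/-- The functional is `y / z`: on the half-line `x = 0 ≤ y`, positivity of `z - lm y` gives `z > 0`.
-/
theorem false_of_lt (h : LienardOrbit lp ap bp lm am bm T x y z) (hbp : bp ≠ 0) (hbm : bm ≠ 0)
    (hlp : 0 ≤ lp) (hlap : lp ≤ ap) (hlam : lm ≤ am) (hlt : lp < lm) : False := by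
  have hlm : 0 ≤ lm := by linarith
  have hwp := h.eigenform_right_pos hlp hlt hbm
  have hwm := h.eigenform_left_pos hlp hlt hbp
  have hz : ∀ t, x t = 0 → 0 ≤ y t → 0 < z t := by
    intro t ht hy
    have h1 := hwm t
    rw [ht] at h1
    simp only [eigenform] at h1
    nlinarith
  refine h.false_of_increasing (fun y z => y / z) ?_ ?_ ?_
    (h.exists_crossing hlp hlap hlm hlam hbm fun t _ => (hwm t).le) ?_
  · exact h.continuous_y.continuousOn.div h.continuous_z.continuousOn
      fun t ht => (hz t ht.1 ht.2).ne'
  · intro t _ hy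
    simp [hy]
  · exact fun t ht hy => div_pos hy (hz t ht hy.le)
  · intro t ht hy
    obtain ⟨c, hc, hneg⟩ := h.exists_neg_right ht hy
    obtain ⟨t₁, k, -, h1, h2, h3, -, h4, h5, -⟩ := h.left_passage hlm hlam ht hc hneg (Or.inl hy)
    obtain ⟨t₂, k', -, h6, h7, h8, -, h9, h10, -⟩ := h.right_passage hlp hlap h1 h2
    refine ⟨t₂, h6, h7, ?_⟩
    have w0 := hwm t
    have w1 := hwp t₁
    rw [ht] at w0
    rw [h1] at w1
    rw [div_lt_div_iff₀ (hz t ht hy.le) (hz t₂ h6 h7.le)]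
    simp only [eigenform] at h4 h9 w0 w1
    -- Eliminating `k` and dividing by the positive `y` factors, `e1` and `e2` say `z₁/|y₁| + lm ≤
    -- z/y - lm` and `z₂/y₂ - lp ≤ z₁/|y₁| + lp`. Their sum is `z₂/y₂ ≤ z/y - 2 (lm - lp)`, which is
    -- strict progress.
    have e1 : (z t₁ - lm * y t₁) * y t ≤ (z t - lm * y t) * -y t₁ := by
      have := mul_le_mul_of_nonneg_left h5 w0.le
      nlinarith
    have e2 : (z t₂ - lp * y t₂) * -y t₁ ≤ (z t₁ - lp * y t₁) * y t₂ := by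
      have := mul_le_mul_of_nonneg_left h10 w1.le
      nlinarith
    have e3 : (z t₂ * y t) * -y t₁ < (y t₂ * z t) * -y t₁ := by
      have f1 := mul_le_mul_of_nonneg_left e1 h7.le
      have f2 := mul_le_mul_of_nonneg_left e2 hy.le
      have f3 := mul_pos (mul_pos (sub_pos.2 hlt) (mul_pos hy h7)) (neg_pos.2 h2)
      nlinarith
    have := lt_of_mul_lt_mul_right e3 (neg_pos.2 h2).le
    linarith

/-- With equal real eigenvalues, the eigenform vanishes or is constant. -/
theorem eigenform_of_eq {l : ℝ} (h : LienardOrbit l ap bp l am bm T x y z) (hl : 0 ≤ l) :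
    (∀ t, eigenform l (x t) (y t) (z t) = 0) ∨
      l = 0 ∧ ∀ s t, eigenform l (x s) (y s) (z s) = eigenform l (x t) (y t) (z t) := by
  have hd : ∀ t, HasDerivAt (fun t => eigenform l (x t) (y t) (z t))
      (l * eigenform l (x t) (y t) (z t)) t := by
    intro t
    rcases le_total 0 (x t) with ht | ht
    · exact (hasDerivAt_eigenform (h.right t ht)).congr_deriv (by ring)
    · exact (hasDerivAt_eigenform (h.left t ht)).congr_deriv (by ring)
  rcases hl.eq_or_lt with rfl | hl
  · refine Or.inr ⟨rfl, fun s t => is_const_of_deriv_eq_zero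
      (fun t => (hd t).differentiableAt) (fun t => ?_) s t⟩
    rw [(hd t).deriv, zero_mul]
  · refine Or.inl fun t => ?_
    -- The square of the eigenform has derivative `2 l w² ≥ 0`, so periodicity makes it vanish.
    have := deriv_eq_zero_of_periodic h.period_pos
      (f := fun t => eigenform l (x t) (y t) (z t) ^ 2)
      (fun t => by simp only [h.periodic_x t, h.periodic_y t, h.periodic_z t])
      (fun t => ((hd t).fun_pow 2).congr_deriv
        (g' := 2 * l * eigenform l (x t) (y t) (z t) ^ 2) (by norm_num; ring))
      (fun t => by positivity) t
    simpa [hl.ne'] using this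

/-- Here `y` itself is the functional. Neither passage shrinks `|y|`, and each alternative of
`hstrict` makes at least one of them strict; the sign `hw` serves only to find a transversal
crossing. -/
theorem false_of_eq {l : ℝ} (h : LienardOrbit l ap bp l am bm T x y z) (hbm : bm ≠ 0)
    (hl : 0 ≤ l) (hlap : l ≤ ap) (hlam : l ≤ am) (hstrict : 0 < l ∨ l < ap ∨ l < am)
    (hw : ∀ t, 0 ≤ eigenform l (x t) (y t) (z t)) : False := by
  refine h.false_of_increasing (fun y _ => y) h.continuous_y.continuousOn
    (fun t _ hy => hy.le) (fun t _ hy => hy)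
    (h.exists_crossing hl hlap hl hlam hbm fun t _ => hw t) ?_
  intro t ht hy
  obtain ⟨c, hc, hneg⟩ := h.exists_neg_right ht hy
  obtain ⟨t₁, k, -, h1, h2, h3, h3', h4, h5, h5'⟩ :=
    h.left_passage hl hlam ht hc hneg (Or.inl hy)
  obtain ⟨t₂, k', -, h6, h7, h8, h8', h9, h10, h10'⟩ := h.right_passage hl hlap h1 h2
  refine ⟨t₂, h6, h7, ?_⟩
  rcases hstrict with hs | hs | hs
  · nlinarith [h3' hs]
  · nlinarith [h10' hs]
  · nlinarith [h5' hs]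

/-- There is no crossing periodic orbit when `α ≥ λ ≥ 0` in both zones, apart from degenerate
cases. -/
theorem false_of_nonneg (h : LienardOrbit lp ap bp lm am bm T x y z) (hbp : bp ≠ 0)
    (hbm : bm ≠ 0) (hlp : 0 ≤ lp) (hlm : 0 ≤ lm) (hlap : lp ≤ ap) (hlam : lm ≤ am)
    (hstrict : 0 < lp ∧ 0 < lm ∨ lp < ap ∨ lm < am) : False := by
  rcases lt_trichotomy lp lm with hlt | rfl | hlt
  · exact h.false_of_lt hbp hbm hlp hlap hlam hlt
  · have hstrict' : 0 < lp ∨ lp < ap ∨ lp < am := hstrict.imp_left And.left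
    have hneg : ∀ t, eigenform lp (-x t) (-y t) (-z t) = -eigenform lp (x t) (y t) (z t) := by
      intro t
      simp only [eigenform]; ring
    rcases h.eigenform_of_eq hlp with hw | ⟨-, hw⟩
    · exact h.false_of_eq hbm hlp hlap hlam hstrict' fun t => (hw t).ge
    · rcases le_total 0 (eigenform lp (x 0) (y 0) (z 0)) with h0 | h0
      · exact h.false_of_eq hbm hlp hlap hlam hstrict' fun t => by rwa [hw t 0]
      · exact h.reflect.false_of_eq hbp hlp hlam hlap (hstrict'.imp_right Or.symm) fun t => by
          rw [hneg, hw t 0]; linarith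
  · exact h.reflect.false_of_lt hbm hbp hlm hlam hlap hlt

end LienardOrbit

end PiecewiseLinear

end

/-! ### The three cases of the theorem -/

theorem corollary4p4 (Ap Am : Matrix (Fin 3) (Fin 3) ℝ)
    (hcont : PiecewiseLinear.ContinuityRelation Ap Am)
    (hobs : PiecewiseLinear.Observable Am)
    (lp ap bp lm am bm : ℝ) (hbp : 0 < bp) (hbm : 0 < bm)
    (hAp : PiecewiseLinear.HasEigenvalues Ap lp ap bp)
    (hAm : PiecewiseLinear.HasEigenvalues Am lm am bm)
    (hper : PiecewiseLinear.HasPeriodicOrbit Ap Am) :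
    (PiecewiseLinear.gam lp ap bp = 0 → PiecewiseLinear.gam lm am bm = 0 → lp * lm ≤ 0) ∧
    (0 ≤ PiecewiseLinear.gam lp ap bp → 0 ≤ PiecewiseLinear.gam lm am bm →
      PiecewiseLinear.gam lp ap bp + PiecewiseLinear.gam lm am bm ≠ 0 → lp < 0 ∨ lm < 0) ∧
    (PiecewiseLinear.gam lp ap bp ≤ 0 → PiecewiseLinear.gam lm am bm ≤ 0 →
      PiecewiseLinear.gam lp ap bp + PiecewiseLinear.gam lm am bm ≠ 0 → 0 < lp ∨ 0 < lm) := by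
  obtain ⟨x, hx⟩ := hper
  obtain ⟨T, u, v, w, h⟩ := hx.exists_lienardOrbit hcont hAp hAm
  have hpos : ∀ l a b : ℝ, 0 < b → (0 ≤ PiecewiseLinear.gam l a b ↔ l ≤ a) := by
    intro l a b hb
    rw [PiecewiseLinear.gam, le_div_iff₀ hb, zero_mul, sub_nonneg]
  have hneg : ∀ l a b : ℝ, 0 < b → (PiecewiseLinear.gam l a b ≤ 0 ↔ a ≤ l) := by
    intro l a b hb
    rw [PiecewiseLinear.gam, div_le_iff₀ hb, zero_mul, sub_nonpos]
  have hzero : ∀ l b : ℝ, PiecewiseLinear.gam l l b = 0 := by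
    intro l b
    simp [PiecewiseLinear.gam]
  refine ⟨fun h1 h2 => ?_, fun h1 h2 h3 => ?_, fun h1 h2 h3 => ?_⟩
  · by_contra! hlt
    have e1 := (hpos lp ap bp hbp).1 h1.ge
    have e2 := (hneg lp ap bp hbp).1 h1.le
    have e3 := (hpos lm am bm hbm).1 h2.ge
    have e4 := (hneg lm am bm hbm).1 h2.le
    rcases mul_pos_iff.1 hlt with ⟨s1, s2⟩ | ⟨s1, s2⟩
    · exact h.false_of_nonneg hbp.ne' hbm.ne' s1.le s2.le e1 e3 (Or.inl ⟨s1, s2⟩)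
    -- Two negative real eigenvalues become positive under time reversal, which keeps `l = a` in
    -- each zone.
    · exact h.reverse.false_of_nonneg hbp.ne' hbm.ne' (by linarith) (by linarith) (by linarith)
        (by linarith) (Or.inl ⟨by linarith, by linarith⟩)
  · by_contra! hl
    rw [hpos _ _ _ hbp] at h1
    rw [hpos _ _ _ hbm] at h2
    refine h.false_of_nonneg hbp.ne' hbm.ne' hl.1 hl.2 h1 h2 (Or.inr ?_)
    by_contra! hge
    obtain rfl := le_antisymm h1 hge.1
    obtain rfl := le_antisymm h2 hge.2
    exact h3 (by rw [hzero, hzero, add_zero])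
  · by_contra! hl
    rw [hneg _ _ _ hbp] at h1
    rw [hneg _ _ _ hbm] at h2
    refine h.reverse.false_of_nonneg hbp.ne' hbm.ne' (by linarith) (by linarith) (by linarith)
      (by linarith) (Or.inr ?_)
    by_contra! hge
    obtain rfl : ap = lp := by linarith
    obtain rfl : am = lm := by linarith
    exact h3 (by rw [hzero, hzero, add_zero])
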